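/- Let $n\ge 1$ and let $L\subseteq\mathbb{C}^n$ be closed. Write $B(\zeta,r)$ for the open Euclidean ball, and let $C(L)$ be the space of continuous functions $L\to\mathbb{C}$ with the Fréchet topology given by the seminorms $|f|_N=\sup_{z\in L,\ \|z\|\le N}|f(z)|$, $N\in\mathbb{N}$. A function $f\in C(L)$ is called holomorphically extendable at $\zeta\in L$ if there are an open neighbourhood $U\subseteq\mathbb{C}^n$ of $\zeta$ and a holomorphic function $F:U\to\mathbb{C}$ with $F=f$ on $U\cap L$. Suppose that $L$ has the following two properties. (1) For every $\zeta\in L$ there is an $r_0>0$ such that either $B(\zeta,r_0)\subseteq L$, or for all $r\in(0,r_0)$ there are a point $w\in B(\zeta,r)\setminus L$ and an $(n-1)$-dimensional complex (affine) hyperplane $H$ that contains $w$ and is disjoint from $B(\zeta,r)\cap L$. (2) For any product $U=U_1\times\cdots\times U_n$ of domains (non-empty connected open sets) $U_i\subseteq\mathbb{C}$, any point $(z_1,\dots,z_n)\in U\cap L$ and any $i\in\{1,\dots,n\}$, the set $\{w\in U_i : (z_1,\dots,z_{i-1},w,z_{i+1},\dots,z_n)\in L\}$ has a limit point in $U_i$.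 Then for every $\zeta\in L$ the set of functions in $C(L)$ that are not holomorphically extendable at $\zeta$ is a dense $G_\delta$ subset of $C(L)$, and the set of functions in $C(L)$ that are not holomorphically extendable at any point of $L$ is also a dense $G_\delta$ subset of $C(L)$. In particular, when $n=1$ these two conclusions hold for every perfect set $L\subseteq\mathbb{C}$ (closed with no isolated points). -/

import Mathlib

open Set Filter Topology

/-- `f ∈ C(L)` is holomorphically extendable at the point `ζ` of `L`: some function `F`,
holomorphic on an open neighbourhood `U` of `ζ` in the ambient space, agrees with `f` on `U ∩ L`.
The ambient space is `ℂⁿ` or `ℂ` below. -/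
def HolomorphicallyExtendableAt {E : Type*} [NormedAddCommGroup E] [NormedSpace ℂ E]
    {L : Set E} (f : C(L, ℂ)) (ζ : L) : Prop :=
  ∃ U : Set E, IsOpen U ∧ (ζ : E) ∈ U ∧
    ∃ F : E → ℂ, DifferentiableOn ℂ F U ∧ ∀ z : L, (z : E) ∈ U → F z = f z

/-- The functions in `C(L)` that are not holomorphically extendable at the point `ζ` of `L`. -/
def nonExtendableAt {E : Type*} [NormedAddCommGroup E] [NormedSpace ℂ E]
    (L : Set E) (ζ : L) : Set C(L, ℂ) :=
  {f | ¬ HolomorphicallyExtendableAt f ζ}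

/-- The functions in `C(L)` that are holomorphically extendable at no point of `L`. -/
def nowhereExtendable {E : Type*} [NormedAddCommGroup E] [NormedSpace ℂ E]
    (L : Set E) : Set C(L, ℂ) :=
  {f | ∀ ζ : L, ¬ HolomorphicallyExtendableAt f ζ}

/-- The affine set `w + {v}^⊥` of `ℂⁿ`, orthogonal complement for the complex inner product;
for `v ≠ 0` this is the general complex hyperplane (of dimension `n - 1`) through `w`. -/
def complexHyperplane {n : ℕ} (w v : EuclideanSpace ℂ (Fin n)) :
    Set (EuclideanSpace ℂ (Fin n)) :=
  {z | inner ℂ v z = inner ℂ v w}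

/-- For each `ζ ∈ L` there is `r₀ > 0` such that either `B(ζ, r₀) ⊆ L`, or for all `r ∈ (0, r₀)`
there are `w ∈ B(ζ, r) \ L` and a complex hyperplane through `w` disjoint from `B(ζ, r) ∩ L`. -/
def HyperplaneCondition {n : ℕ} (L : Set (EuclideanSpace ℂ (Fin n))) : Prop :=
  ∀ ζ ∈ L, ∃ r₀ : ℝ, 0 < r₀ ∧
    (Metric.ball ζ r₀ ⊆ L ∨
      ∀ r ∈ Ioo 0 r₀, ∃ w ∈ Metric.ball ζ r \ L, ∃ v : EuclideanSpace ℂ (Fin n), v ≠ 0 ∧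
        Disjoint (complexHyperplane w v) (Metric.ball ζ r ∩ L))

/-- For all domains `U₁, …, Uₙ` of `ℂ`, each point `z ∈ (U₁ × ⋯ × Uₙ) ∩ L` and each `i`, the slice
`{w ∈ Uᵢ : (z₁, …, zᵢ₋₁, w, zᵢ₊₁, …, zₙ) ∈ L}` has a limit point in `Uᵢ`. -/
def SliceCondition {n : ℕ} (L : Set (EuclideanSpace ℂ (Fin n))) : Prop :=
  ∀ U : Fin n → Set ℂ, (∀ i, IsOpen (U i) ∧ IsConnected (U i)) →
    ∀ z ∈ L, (∀ i, z i ∈ U i) → ∀ i, ∃ a ∈ U i,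
      AccPt a (𝓟 {w : ℂ | w ∈ U i ∧ WithLp.toLp 2 (Function.update (fun j => z j) i w) ∈ L})

/-! The proof is a Baire category argument. The functions extendable at `ζ` form the countable union
of the sets of those extending to `B(ζ, 1/(m+1))` with bound `k`. Each set is closed by Montel's
theorem. If one had an interior point, linearity would extend every `f ∈ C(L)` to that ball
(`exists_extension_of_interior_nonempty`).

`exists_not_extendable` rules this out. If `L` contains a ball about `ζ`, then `‖z - ζ‖` does not
extend. Otherwise take a hyperplane `l = l w` that misses `L` near `ζ`: the function `1 / (l z - l
w)` on `L` near `ζ` cannot extend past `w`, since by uniqueness an extension `F` would satisfy `F *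
(l - l w) = 1` at `w` too. Uniqueness comes from the slice condition, one coordinate at a time. -/

/-! ### Cauchy estimates and Montel's theorem -/

/-- First and second order Schwarz bounds at the centre of a disc. -/
theorem norm_deriv_le_and_norm_taylor_le {g : ℂ → ℂ} {ρ M : ℝ} (hρ : 0 < ρ)
    (hg : DifferentiableOn ℂ g (Metric.ball 0 ρ)) (hM : ∀ z ∈ Metric.ball (0 : ℂ) ρ, ‖g z‖ ≤ M) :
    ‖deriv g 0‖ ≤ 2 * M / ρ ∧
      ∀ z ∈ Metric.ball (0 : ℂ) ρ, ‖g z - g 0 - z * deriv g 0‖ ≤ 4 * M / ρ ^ 2 * ‖z‖ ^ 2 := by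
  have h0 : (0 : ℂ) ∈ Metric.ball (0 : ℂ) ρ := Metric.mem_ball_self hρ
  have hmaps {k : ℂ → ℂ} {K : ℝ} (hk : ∀ z ∈ Metric.ball (0 : ℂ) ρ, ‖k z‖ ≤ K) :
      MapsTo k (Metric.ball 0 ρ) (Metric.closedBall (k 0) (2 * K)) := by
    intro z hz
    rw [mem_closedBall_iff_norm]
    linarith [norm_sub_le (k z) (k 0), hk z hz, hk 0 h0]
  have h1 : ∀ z ∈ Metric.ball (0 : ℂ) ρ, ‖dslope g 0 z‖ ≤ 2 * M / ρ := fun z hz =>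
    Complex.norm_dslope_le_div_of_mapsTo_ball hg (hmaps hM) hz
  -- The Schwarz bound is applied again, to `dslope g 0`; the iterated slope is the second-order
  -- remainder divided by `z ^ 2`.
  have hd : DifferentiableOn ℂ (dslope g 0) (Metric.ball 0 ρ) :=
    (Complex.differentiableOn_dslope (Metric.isOpen_ball.mem_nhds h0)).2 hg
  have h2 : ∀ z ∈ Metric.ball (0 : ℂ) ρ, ‖dslope (dslope g 0) 0 z‖ ≤ 2 * (2 * M / ρ) / ρ :=
    fun z hz => Complex.norm_dslope_le_div_of_mapsTo_ball hd (hmaps h1) hz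
  refine ⟨by simpa using h1 0 h0, fun z hz => ?_⟩
  have e1 := sub_smul_dslope g 0 z
  have e2 := sub_smul_dslope (dslope g 0) 0 z
  simp only [sub_zero, smul_eq_mul, dslope_same] at e1 e2
  have e3 : g z - g 0 - z * deriv g 0 = dslope (dslope g 0) 0 z * z ^ 2 := by
    rw [← e1]; linear_combination -z * e2
  rw [e3, norm_mul, norm_pow]
  refine mul_le_mul_of_nonneg_right ((h2 z hz).trans_eq ?_) (by positivity)
  field_simp
  ring

section

variable {E : Type*} [NormedAddCommGroup E] [NormedSpace ℂ E]

/-- First and second order Cauchy bounds for a bounded holomorphic function on a ball. -/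
theorem norm_fderiv_le_and_norm_taylor_le {F : E → ℂ} {x : E} {δ M : ℝ} (hδ : 0 < δ)
    (hF : DifferentiableOn ℂ F (Metric.ball x δ)) (hM : ∀ z ∈ Metric.ball x δ, ‖F z‖ ≤ M) :
    ‖fderiv ℂ F x‖ ≤ 2 * M / δ ∧
      ∀ h : E, ‖h‖ < δ → ‖F (x + h) - F x - fderiv ℂ F x h‖ ≤ 4 * M / δ ^ 2 * ‖h‖ ^ 2 := by
  have hx : x ∈ Metric.ball x δ := Metric.mem_ball_self hδ
  have hM0 : 0 ≤ M := (norm_nonneg _).trans (hM x hx)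
  have key (h : E) (hh : h ≠ 0) : ‖fderiv ℂ F x h‖ ≤ 2 * M / δ * ‖h‖ ∧ (‖h‖ < δ →
      ‖F (x + h) - F x - fderiv ℂ F x h‖ ≤ 4 * M / δ ^ 2 * ‖h‖ ^ 2) := by
    have hn : 0 < ‖h‖ := norm_pos_iff.2 hh
    have hmaps : MapsTo (fun t : ℂ => x + t • h) (Metric.ball 0 (δ / ‖h‖)) (Metric.ball x δ) := by
      intro t ht
      rw [mem_ball_zero_iff, lt_div_iff₀ hn] at ht
      simpa [mem_ball_iff_norm, norm_smul] using ht
    have hline : Differentiable ℂ (fun t : ℂ => x + t • h) := by fun_prop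
    have hder : HasDerivAt (fun t : ℂ => F (x + t • h)) (fderiv ℂ F x h) 0 := by
      have hFx : HasFDerivAt F (fderiv ℂ F x) (x + (0 : ℂ) • h) := by
        simpa using (hF.differentiableAt (Metric.isOpen_ball.mem_nhds hx)).hasFDerivAt
      refine hFx.comp_hasDerivAt (0 : ℂ) ?_
      simpa using ((hasDerivAt_id (0 : ℂ)).smul_const h).const_add x
    -- One-variable bounds on the complex line through `x` in direction `h`; the Taylor bound is
    -- then read at `t = 1`.
    obtain ⟨b1, b2⟩ := norm_deriv_le_and_norm_taylor_le (g := fun t : ℂ => F (x + t • h))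
      (div_pos hδ hn) (hF.comp hline.differentiableOn hmaps) (fun t ht => hM _ (hmaps ht))
    rw [hder.deriv] at b1 b2
    refine ⟨b1.trans_eq (by field_simp), fun hlt => ?_⟩
    have := b2 1 (by simpa [lt_div_iff₀ hn] using hlt)
    simp only [one_smul, zero_smul, add_zero, one_mul, norm_one] at this
    exact this.trans_eq (by field_simp)
  constructor
  · refine ContinuousLinearMap.opNorm_le_bound _ (by positivity) fun h => ?_
    rcases eq_or_ne h 0 with rfl | hh
    · simp
    · exact (key h hh).1
  · intro h hlt
    rcases eq_or_ne h 0 with rfl | hh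
    · simp
    · exact (key h hh).2 hlt

/-- Montel's theorem on a ball, for ultrafilters. -/
theorem exists_differentiableOn_tendsto_ultrafilter [FiniteDimensional ℂ E] {ι : Type*}
    (u : Ultrafilter ι) {F : ι → E → ℂ} {ζ : E} {r M : ℝ}
    (hF : ∀ᶠ i in (u : Filter ι), DifferentiableOn ℂ (F i) (Metric.ball ζ r))
    (hM : ∀ᶠ i in (u : Filter ι), ∀ z ∈ Metric.ball ζ r, ‖F i z‖ ≤ M) :
    ∃ G : E → ℂ, DifferentiableOn ℂ G (Metric.ball ζ r) ∧ (∀ z ∈ Metric.ball ζ r, ‖G z‖ ≤ M) ∧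
      ∀ z ∈ Metric.ball ζ r, Tendsto (fun i => F i z) u (𝓝 (G z)) := by
  have hlim (x : E) (hx : x ∈ Metric.ball ζ r) :
      ∃ a : ℂ, ‖a‖ ≤ M ∧ Tendsto (fun i => F i x) u (𝓝 a) := by
    obtain ⟨a, ha, hua⟩ := (isCompact_closedBall (0 : ℂ) M).ultrafilter_le_nhds'
      (u.map fun i => F i x) (show ∀ᶠ i in (u : Filter ι), F i x ∈ Metric.closedBall 0 M by
        filter_upwards [hM] with i hi
        simpa using hi x hx)
    exact ⟨a, by simpa using ha, hua⟩
  choose! G hGM hG using hlim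
  refine ⟨G, fun x hx => ?_, hGM, hG⟩
  obtain ⟨δ, hδ, hsub⟩ := Metric.isOpen_iff.1 Metric.isOpen_ball x hx
  have hbd : ∀ᶠ i in (u : Filter ι), ‖fderiv ℂ (F i) x‖ ≤ 2 * M / δ ∧ ∀ h : E, ‖h‖ < δ →
      ‖F i (x + h) - F i x - fderiv ℂ (F i) x h‖ ≤ 4 * M / δ ^ 2 * ‖h‖ ^ 2 := by
    filter_upwards [hF, hM] with i hi hi'
    exact norm_fderiv_le_and_norm_taylor_le hδ (hi.mono hsub) fun z hz => hi' z (hsub hz)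
  have : ProperSpace (E →L[ℂ] ℂ) := FiniteDimensional.proper ℂ _
  obtain ⟨A, -, hA⟩ := (isCompact_closedBall (0 : E →L[ℂ] ℂ) (2 * M / δ)).ultrafilter_le_nhds'
    (u.map fun i => fderiv ℂ (F i) x) (show ∀ᶠ i in (u : Filter ι),
        fderiv ℂ (F i) x ∈ Metric.closedBall 0 (2 * M / δ) by
      filter_upwards [hbd] with i hi
      simpa using hi.1)
  have hA' : Tendsto (fun i => fderiv ℂ (F i) x) u (𝓝 A) := hA
  -- The remainder bound is uniform in `i`, so it survives the pointwise limit and makes `A` the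
  -- derivative of `G`.
  have hT (h : E) (hh : ‖h‖ < δ) : ‖G (x + h) - G x - A h‖ ≤ 4 * M / δ ^ 2 * ‖h‖ ^ 2 := by
    have hmem : x + h ∈ Metric.ball ζ r := hsub (by simpa [mem_ball_iff_norm] using hh)
    refine le_of_tendsto (((hG _ hmem).sub (hG x hx)).sub
      (((ContinuousLinearMap.apply ℂ ℂ h).continuous.tendsto A).comp hA')).norm ?_
    filter_upwards [hbd] with i hi
    exact hi.2 h hh
  have hder : HasFDerivAt G A x := by
    rw [hasFDerivAt_iff_isLittleO_nhds_zero]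
    have hO : (fun h : E => G (x + h) - G x - A h) =O[𝓝 0] fun h => ‖h‖ ^ 2 := by
      refine Asymptotics.IsBigO.of_bound (4 * M / δ ^ 2) ?_
      filter_upwards [Metric.ball_mem_nhds (0 : E) hδ] with h hh
      simpa using hT h (by simpa using hh)
    exact hO.trans_isLittleO (Asymptotics.isLittleO_norm_pow_id one_lt_two)
  exact hder.differentiableAt.differentiableWithinAt

end

/-! ### Baire category argument -/

section

variable {E : Type*} [NormedAddCommGroup E] [NormedSpace ℂ E]

/-- The functions in `C(L)` with a holomorphic extension to `B(ζ, r)` that is bounded by `M`. -/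
def boundedlyExtendable (L : Set E) (ζ : E) (r M : ℝ) : Set C(L, ℂ) :=
  {f | ∃ F : E → ℂ, DifferentiableOn ℂ F (Metric.ball ζ r) ∧ (∀ z ∈ Metric.ball ζ r, ‖F z‖ ≤ M) ∧
    ∀ z : L, (z : E) ∈ Metric.ball ζ r → F z = f z}

theorem isClosed_boundedlyExtendable [FiniteDimensional ℂ E] (L : Set E) (ζ : E) (r M : ℝ) :
    IsClosed (boundedlyExtendable L ζ r M) := by
  rw [isClosed_iff_ultrafilter]
  intro f u huf hu
  have hex : ∀ g ∈ boundedlyExtendable L ζ r M, ∃ F : E → ℂ,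
    DifferentiableOn ℂ F (Metric.ball ζ r) ∧ (∀ z ∈ Metric.ball ζ r, ‖F z‖ ≤ M) ∧
    ∀ z : L, (z : E) ∈ Metric.ball ζ r → F z = g z := fun g hg => hg
  choose! F hF hFM hFL using hex
  have hu' : ∀ᶠ g in (u : Filter C(L, ℂ)), g ∈ boundedlyExtendable L ζ r M := hu
  obtain ⟨G, hG, hGM, hlim⟩ := exists_differentiableOn_tendsto_ultrafilter u
    (hu'.mono hF) (hu'.mono hFM)
  refine ⟨G, hG, hGM, fun z hz => tendsto_nhds_unique (hlim z hz) ?_⟩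
  have hev : Tendsto (fun g : C(L, ℂ) => g z) u (𝓝 (f z)) :=
    ((ContinuousEvalConst.continuous_eval_const z).tendsto f).mono_left huf
  refine hev.congr' ?_
  filter_upwards [hu'] with g hg
  exact (hFL g hg z hz).symm

/-- A holomorphic extension is continuous at `ζ`, hence bounded on a small enough ball. -/
theorem setOf_holomorphicallyExtendableAt (L : Set E) (ζ : L) :
    {f : C(L, ℂ) | HolomorphicallyExtendableAt f ζ} =
      ⋃ p : ℕ × ℕ, boundedlyExtendable L ζ (1 / ((p.1 : ℝ) + 1)) p.2 := by
  ext f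
  simp only [mem_ofPred_eq, mem_iUnion, Prod.exists]
  constructor
  · rintro ⟨U, hU, hζ, F, hF, hFf⟩
    have hcont : ContinuousAt F ζ :=
      (hF.differentiableAt (hU.mem_nhds hζ)).continuousAt
    obtain ⟨k, hk⟩ := exists_nat_gt ‖F ζ‖
    obtain ⟨ε, hε, hsub⟩ := Metric.mem_nhds_iff.1
      (inter_mem (hU.mem_nhds hζ) (hcont.norm.eventually_lt_const hk))
    obtain ⟨m, hm⟩ := exists_nat_one_div_lt hε
    have hball := (Metric.ball_subset_ball hm.le).trans hsub
    exact ⟨m, k, F, hF.mono fun z hz => (hball hz).1, fun z hz => le_of_lt (hball hz).2,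
      fun z hz => hFf z (hball hz).1⟩
  · rintro ⟨m, k, F, hF, -, hFf⟩
    exact ⟨_, Metric.isOpen_ball, Metric.mem_ball_self (by positivity), F, hF, hFf⟩

/-- If boundedly extendable functions have an interior point, all functions extend. -/
theorem exists_extension_of_interior_nonempty {L : Set E} {ζ : E} {r M : ℝ}
    (h : (interior (boundedlyExtendable L ζ r M)).Nonempty) (f : C(L, ℂ)) :
    ∃ F : E → ℂ, DifferentiableOn ℂ F (Metric.ball ζ r) ∧
      ∀ z : L, (z : E) ∈ Metric.ball ζ r → F z = f z := by
  obtain ⟨f₀, hf₀⟩ := h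
  -- For small `t ≠ 0` both `f₀` and `f₀ + t • f` extend; their difference divided by `t` extends
  -- `f`.
  have hcont : Continuous fun t : ℂ => f₀ + t • f := by fun_prop
  have hev : ∀ᶠ t : ℂ in 𝓝 0, f₀ + t • f ∈ boundedlyExtendable L ζ r M := by
    refine hcont.continuousAt.eventually_mem (mem_interior_iff_mem_nhds.1 ?_)
    rwa [zero_smul ℂ f, add_zero]
  obtain ⟨t, ⟨F₁, hF₁, -, h₁⟩, ht⟩ :=
    ((hev.filter_mono nhdsWithin_le_nhds).and
      (self_mem_nhdsWithin : ∀ᶠ t : ℂ in 𝓝[≠] 0, t ≠ 0)).exists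
  obtain ⟨F₀, hF₀, -, h₀⟩ := interior_subset hf₀
  refine ⟨fun z => t⁻¹ * (F₁ z - F₀ z), (hF₁.sub hF₀).const_mul _, fun z hz => ?_⟩
  simp only [h₀ z hz, h₁ z hz, ContinuousMap.add_apply, ContinuousMap.smul_apply, smul_eq_mul]
  rw [add_sub_cancel_left, inv_mul_cancel_left₀ ht]

/-- A holomorphic function on a ball that vanishes near the centre vanishes. -/
theorem eq_zero_of_eventuallyEq_zero_center {G : E → ℂ} {ζ : E} {r : ℝ}
    (hG : DifferentiableOn ℂ G (Metric.ball ζ r)) (h0 : G =ᶠ[𝓝 ζ] 0) {w : E}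
    (hw : w ∈ Metric.ball ζ r) : G w = 0 := by
  rcases eq_or_ne w ζ with rfl | hne
  · exact h0.eq_of_nhds
  have hn : 0 < ‖w - ζ‖ := norm_pos_iff.2 (sub_ne_zero.2 hne)
  have hr : 0 < r := Metric.pos_of_mem_ball hw
  have hmaps : MapsTo (fun t : ℂ => ζ + t • (w - ζ)) (Metric.ball 0 (r / ‖w - ζ‖))
      (Metric.ball ζ r) := by
    intro t ht
    rw [mem_ball_zero_iff, lt_div_iff₀ hn] at ht
    simpa [mem_ball_iff_norm, norm_smul] using ht
  have hline : Differentiable ℂ (fun t : ℂ => ζ + t • (w - ζ)) := by fun_prop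
  have hev : (fun t : ℂ => G (ζ + t • (w - ζ))) =ᶠ[𝓝 0] 0 := by
    have hc : Tendsto (fun t : ℂ => ζ + t • (w - ζ)) (𝓝 0) (𝓝 ζ) := by
      simpa using hline.continuous.tendsto 0
    exact hc.eventually h0
  have hana : AnalyticOnNhd ℂ (fun t : ℂ => G (ζ + t • (w - ζ)))
      (Metric.ball 0 (r / ‖w - ζ‖)) :=
    (hG.comp hline.differentiableOn hmaps).analyticOnNhd Metric.isOpen_ball
  have := hana.eqOn_zero_of_preconnected_of_eventuallyEq_zero
    (convex_ball _ _).isPreconnected (Metric.mem_ball_self (by positivity)) hev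
    (show (1 : ℂ) ∈ _ by
      rw [mem_ball_iff_norm] at hw
      simpa [lt_div_iff₀ hn] using hw)
  simpa using this

/-- Holomorphic functions near `ζ` that vanish on `L` vanish near `ζ`. -/
def IsUniquenessSetAt (L : Set E) (ζ : E) : Prop :=
  ∀ r : ℝ, 0 < r → ∀ G : E → ℂ, DifferentiableOn ℂ G (Metric.ball ζ r) →
    (∀ z ∈ L, z ∈ Metric.ball ζ r → G z = 0) → G =ᶠ[𝓝 ζ] 0

/-- `B(ζ, r) ⊆ L` for small `r`, or hyperplanes through points of `B(ζ, r) \ L` avoid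
`B(ζ, r) ∩ L`, for all small `r`. -/
def HyperplaneConditionAt (L : Set E) (ζ : E) : Prop :=
  ∃ r₀ : ℝ, 0 < r₀ ∧ (Metric.ball ζ r₀ ⊆ L ∨ ∀ r ∈ Ioo 0 r₀, ∃ w ∈ Metric.ball ζ r,
    ∃ l : E →L[ℂ] ℂ, ∀ z ∈ L, z ∈ Metric.ball ζ r → l z ≠ l w)

/-- The real part of `F` would make the norm real-differentiable at the origin. -/
theorem not_differentiableOn_ofReal_norm_sub [Nontrivial E] {ζ : E} {r : ℝ} (hr : 0 < r)
    {F : E → ℂ} (hF : DifferentiableOn ℂ F (Metric.ball ζ r)) :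
    ¬ ∀ z ∈ Metric.ball ζ r, F z = (‖z - ζ‖ : ℂ) := by
  intro h
  let _ : NormedSpace ℝ E := NormedSpace.restrictScalars ℝ ℂ E
  have hd : DifferentiableAt ℂ (fun z : E => F (ζ + z)) 0 := by
    have : DifferentiableAt ℂ F (ζ + 0) := by
      simpa using hF.differentiableAt (Metric.ball_mem_nhds ζ hr)
    exact this.comp (0 : E) (by fun_prop)
  have hre : DifferentiableAt ℝ (fun z : E => (F (ζ + z)).re) 0 :=
    (Complex.reCLM.differentiableAt).comp (0 : E) (hd.restrictScalars ℝ)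
  refine not_differentiableAt_norm_zero E (hre.congr_of_eventuallyEq ?_)
  filter_upwards [Metric.ball_mem_nhds (0 : E) hr] with z hz
  rw [h (ζ + z) (by simpa [mem_ball_iff_norm] using hz)]
  simp

/-- Some function in `C(L)` does not extend to `B(ζ, r)`. -/
theorem exists_not_extendable [FiniteDimensional ℂ E] [Nontrivial E] {L : Set E}
    (hL : IsClosed L) {ζ : E} (hζ : ζ ∈ L) (hH : HyperplaneConditionAt L ζ)
    (hU : IsUniquenessSetAt L ζ) {r : ℝ} (hr : 0 < r) :
    ∃ f : C(L, ℂ), ∀ F : E → ℂ, DifferentiableOn ℂ F (Metric.ball ζ r) →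
      ¬ ∀ z : L, (z : E) ∈ Metric.ball ζ r → F z = f z := by
  obtain ⟨r₀, hr₀, hsub | hH⟩ := hH
  · refine ⟨⟨fun z => (‖(z : E) - ζ‖ : ℂ), by fun_prop⟩, fun F hF h => ?_⟩
    refine not_differentiableOn_ofReal_norm_sub (lt_min hr hr₀)
      (hF.mono (Metric.ball_subset_ball (min_le_left r r₀))) fun z hz => ?_
    exact h ⟨z, hsub (Metric.ball_subset_ball (min_le_right r r₀) hz)⟩
      (Metric.ball_subset_ball (min_le_left r r₀) hz)
  obtain ⟨s, hs0, hs⟩ := exists_between (lt_min hr hr₀)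
  obtain ⟨w, hw, l, hl⟩ := hH s ⟨hs0, hs.trans_le (min_le_right _ _)⟩
  -- Shrinking to a closed ball that still has `w` inside gives a compact part of `L`, on which `‖l
  -- z - l w‖` has a positive minimum `δ`.
  obtain ⟨t, hwt, hts⟩ := exists_between (Metric.mem_ball.1 hw)
  have ht0 : 0 < t := dist_nonneg.trans_lt hwt
  have : ProperSpace E := FiniteDimensional.proper ℂ E
  have hK : IsCompact (L ∩ Metric.closedBall ζ t) :=
    (isCompact_closedBall ζ t).inter_left hL
  obtain ⟨z₀, hz₀, hmin⟩ := hK.exists_isMinOn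
    ⟨ζ, hζ, Metric.mem_closedBall_self ht0.le⟩
    (show ContinuousOn (fun z => ‖l z - l w‖) _ by fun_prop)
  have hδ : 0 < ‖l z₀ - l w‖ := norm_pos_iff.2 (sub_ne_zero.2
    (hl z₀ hz₀.1 (Metric.closedBall_subset_ball hts hz₀.2)))
  set δ := ‖l z₀ - l w‖
  have hpos (z : E) : 0 < max (‖l z - l w‖ ^ 2) (δ ^ 2) := lt_max_of_lt_right (by positivity)
  -- This is `1 / (l z - l w)` wherever `‖l z - l w‖ ≥ δ`; the maximum keeps it continuous on all of
  -- `L`.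
  refine ⟨⟨fun z => (starRingEnd ℂ) (l z - l w) /
    ((max (‖l z - l w‖ ^ 2) (δ ^ 2) : ℝ) : ℂ), ?_⟩, fun F hF h => ?_⟩
  · refine Continuous.div ?_ ?_ fun z => ?_
    · exact Complex.continuous_conj.comp (by fun_prop)
    · exact Complex.continuous_ofReal.comp (by fun_prop)
    · exact_mod_cast (hpos z).ne'
  have htr : Metric.ball ζ t ⊆ Metric.ball ζ r :=
    Metric.ball_subset_ball (hts.le.trans (hs.le.trans (min_le_left _ _)))
  have hG : DifferentiableOn ℂ (fun z => F z * (l z - l w) - 1) (Metric.ball ζ t) :=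
    ((hF.mono htr).mul (by fun_prop)).sub_const 1
  have hzero := hU t ht0 _ hG fun z hz hzt => by
    have hmz : δ ≤ ‖l z - l w‖ := hmin ⟨hz, Metric.ball_subset_closedBall hzt⟩
    have hne : (‖l z - l w‖ : ℂ) ≠ 0 := by exact_mod_cast (hδ.trans_le hmz).ne'
    have hval := h ⟨z, hz⟩ (htr hzt)
    simp only [ContinuousMap.coe_mk] at hval
    rw [hval, max_eq_left (pow_le_pow_left₀ hδ.le hmz 2), div_mul_eq_mul_div, mul_comm,
      Complex.mul_conj, Complex.normSq_eq_norm_sq, div_self, sub_self]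
    push_cast
    exact pow_ne_zero 2 hne
  -- At `w` the vanishing function equals `-1`.
  simpa using eq_zero_of_eventuallyEq_zero_center hG hzero hwt

/-- The abstract form of the main theorem. -/
theorem isGδ_and_dense_nonExtendable [FiniteDimensional ℂ E] [Nontrivial E] {L : Set E}
    (hL : IsClosed L) (hH : ∀ ζ ∈ L, HyperplaneConditionAt L ζ)
    (hU : ∀ ζ ∈ L, IsUniquenessSetAt L ζ) :
    (∀ ζ : L, IsGδ (nonExtendableAt L ζ) ∧ Dense (nonExtendableAt L ζ)) ∧
      (IsGδ (nowhereExtendable L) ∧ Dense (nowhereExtendable L)) := by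
  have : ProperSpace E := FiniteDimensional.proper ℂ E
  -- With second countability, this makes `C(L)` completely metrizable, hence a Baire space.
  have : LocallyCompactSpace L := hL.isClosedEmbedding_subtypeVal.locallyCompactSpace
  have hpt (ζ : L) : IsGδ (nonExtendableAt L ζ) ∧ Dense (nonExtendableAt L ζ) := by
    have heq : nonExtendableAt L ζ =
        ⋂ p : ℕ × ℕ, (boundedlyExtendable L ζ (1 / ((p.1 : ℝ) + 1)) p.2)ᶜ := by
      rw [← compl_iUnion, ← setOf_holomorphicallyExtendableAt]
      rfl
    have hopen (p : ℕ × ℕ) : IsOpen (boundedlyExtendable L (ζ : E) (1 / ((p.1 : ℝ) + 1)) p.2)ᶜ :=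
      (isClosed_boundedlyExtendable _ _ _ _).isOpen_compl
    rw [heq]
    refine ⟨.iInter_of_isOpen hopen, dense_iInter_of_isOpen hopen fun p => ?_⟩
    rw [← interior_eq_empty_iff_dense_compl, ← not_nonempty_iff_eq_empty]
    intro hne
    obtain ⟨f, hf⟩ := exists_not_extendable hL ζ.2 (hH ζ ζ.2) (hU ζ ζ.2)
      (r := 1 / ((p.1 : ℝ) + 1)) (by positivity)
    obtain ⟨F, hF, hFf⟩ := exists_extension_of_interior_nonempty hne f
    exact hf F hF hFf
  refine ⟨hpt, ?_⟩
  obtain ⟨D, hDc, hDd⟩ := TopologicalSpace.exists_countable_dense L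
  -- Extendability at `ζ` persists at nearby points of `L`, so a countable dense set of points
  -- suffices.
  have heq : nowhereExtendable L = ⋂ ζ ∈ D, nonExtendableAt L ζ := by
    ext f
    simp only [nowhereExtendable, nonExtendableAt, mem_ofPred_eq, mem_iInter]
    refine ⟨fun h ζ _ => h ζ, fun h ζ => ?_⟩
    rintro ⟨U, hUo, hζ, F, hF, hFf⟩
    obtain ⟨η, hηU, hηD⟩ := hDd.exists_mem_open (hUo.preimage continuous_subtype_val) ⟨ζ, hζ⟩
    exact h η hηU ⟨U, hUo, hηD, F, hF, hFf⟩
  rw [heq]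
  exact ⟨.biInter hDc fun ζ _ => (hpt ζ).1,
    dense_biInter_of_Gδ (fun ζ _ => (hpt ζ).1) hDc fun ζ _ => (hpt ζ).2⟩

end

/-! ### Hyperplane and slice conditions, and perfect plane sets -/

theorem HyperplaneCondition.hyperplaneConditionAt {n : ℕ} {L : Set (EuclideanSpace ℂ (Fin n))}
    (h : HyperplaneCondition L) : ∀ ζ ∈ L, HyperplaneConditionAt L ζ := by
  intro ζ hζ
  obtain ⟨r₀, hr₀, hsub | h⟩ := h ζ hζ
  · exact ⟨r₀, hr₀, .inl hsub⟩
  refine ⟨r₀, hr₀, .inr fun r hr => ?_⟩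
  obtain ⟨w, hw, v, -, hd⟩ := h r hr
  exact ⟨w, hw.1, innerSL ℂ v, fun z hz hzr heq =>
    disjoint_left.1 hd (show z ∈ complexHyperplane w v from heq) ⟨hzr, hz⟩⟩

/-- A holomorphic function on a product domain that vanishes on `L` vanishes, if the product domain
meets `L`. -/
theorem SliceCondition.eq_zero {n : ℕ} {L : Set (EuclideanSpace ℂ (Fin n))}
    (hL : SliceCondition L) {U : Fin n → Set ℂ} (hU : ∀ i, IsOpen (U i) ∧ IsConnected (U i))
    {G : EuclideanSpace ℂ (Fin n) → ℂ} (hG : DifferentiableOn ℂ G {z | ∀ i, z i ∈ U i})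
    (hG0 : ∀ z ∈ L, (∀ i, z i ∈ U i) → G z = 0) {ζ : EuclideanSpace ℂ (Fin n)} (hζ : ζ ∈ L)
    (hζU : ∀ i, ζ i ∈ U i) {u : EuclideanSpace ℂ (Fin n)} (hu : ∀ i, u i ∈ U i) : G u = 0 := by
  -- Coordinates of `z` are replaced by those of `u` one at a time. The mixed point may leave `L`,
  -- so the claim ranges over all `z ∈ L`: the slice condition varies coordinate `i` of `z` itself,
  -- and the induction hypothesis applies to the varied point.
  have key (s : Finset (Fin n)) : ∀ z ∈ L, (∀ i, z i ∈ U i) →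
      G (WithLp.toLp 2 (s.piecewise (fun j => u j) fun j => z j)) = 0 := by
    induction s using Finset.induction_on with
    | empty => simpa using hG0
    | insert i s his ih =>
      intro z hz hzU
      obtain ⟨a, haU, ha⟩ := hL U hU z hz hzU i
      set b : Fin n → ℂ := s.piecewise (fun j => u j) fun j => z j with hb
      have hbU (j : Fin n) : b j ∈ U j := by
        by_cases hj : j ∈ s <;> simp [hb, hj, hu, hzU]
      have hline : Differentiable ℂ fun w : ℂ =>
          (WithLp.toLp 2 (Function.update b i w) : EuclideanSpace ℂ (Fin n)) := fun w =>
        ((EuclideanSpace.equiv (Fin n) ℂ).symm.differentiable _).comp w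
          (hasFDerivAt_update b w).differentiableAt
      have hmaps : MapsTo (fun w : ℂ =>
          (WithLp.toLp 2 (Function.update b i w) : EuclideanSpace ℂ (Fin n)))
          (U i) {z | ∀ i, z i ∈ U i} := by
        intro w hw j
        rcases eq_or_ne j i with rfl | hj
        · simpa using hw
        · simpa [hj] using hbU j
      have hana := (hG.comp hline.differentiableOn hmaps).analyticOnNhd (hU i).1
      have hzero := hana.eqOn_zero_of_preconnected_of_frequently_eq_zero
        (hU i).2.isPreconnected haU (by
          rw [accPt_iff_frequently_nhdsNE] at ha
          refine ha.mono fun w hw => ?_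
          have := ih _ hw.2 fun j => by
            rcases eq_or_ne j i with rfl | hj
            · simpa using hw.1
            · simpa [hj] using hzU j
          simp only [Function.comp_apply]
          convert this using 3
          ext j
          by_cases hj : j ∈ s
          · have : j ≠ i := fun h => his (h ▸ hj)
            simp [hb, hj, this]
          · rcases eq_or_ne j i with rfl | hji <;> simp [*])
      rw [Finset.piecewise_insert]
      exact hzero (hu i)
  simpa using key Finset.univ ζ hζ hζU

theorem SliceCondition.isUniquenessSetAt {n : ℕ} {L : Set (EuclideanSpace ℂ (Fin n))}
    (hL : SliceCondition L) : ∀ ζ ∈ L, IsUniquenessSetAt L ζ := by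
  intro ζ hζ r hr G hG hG0
  have hnhds : Metric.ball ζ r ∈ 𝓝 ζ := Metric.ball_mem_nhds ζ hr
  obtain ⟨ε, hε, hsub⟩ : ∃ ε > 0, {z : EuclideanSpace ℂ (Fin n) | ∀ i, z i ∈
      Metric.ball (ζ i) ε} ⊆ Metric.ball ζ r := by
    have hc : Tendsto (EuclideanSpace.equiv (Fin n) ℂ).symm
        (𝓝 (EuclideanSpace.equiv (Fin n) ℂ ζ)) (𝓝 ζ) := by
      simpa using (EuclideanSpace.equiv (Fin n) ℂ).symm.continuous.tendsto
        (EuclideanSpace.equiv (Fin n) ℂ ζ)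
    obtain ⟨ε, hε, h⟩ := Metric.mem_nhds_iff.1 (hc hnhds)
    refine ⟨ε, hε, fun z hz => ?_⟩
    have : EuclideanSpace.equiv (Fin n) ℂ z ∈
        Metric.ball (EuclideanSpace.equiv (Fin n) ℂ ζ) ε := by
      rw [Metric.mem_ball, dist_pi_lt_iff hε]
      exact hz
    simpa using h this
  have hev : ∀ᶠ z in 𝓝 ζ, ∀ i, z i ∈ Metric.ball (ζ i) ε :=
    eventually_all.2 fun i =>
      ((EuclideanSpace.proj i : EuclideanSpace ℂ (Fin n) →L[ℂ] ℂ).continuous.tendsto ζ)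
        (Metric.ball_mem_nhds _ hε)
  filter_upwards [hev] with u hu
  exact hL.eq_zero (U := fun i => Metric.ball (ζ i) ε)
    (fun i => ⟨Metric.isOpen_ball, (convex_ball _ _).isConnected ⟨_, Metric.mem_ball_self hε⟩⟩)
    (hG.mono hsub) (fun z hz hzU => hG0 z hz (hsub hzU)) hζ
    (fun i => Metric.mem_ball_self hε) hu

/-- In dimension one a hyperplane is a point, so any `w` outside `L` serves, with `l` the identity.
-/
theorem hyperplaneConditionAt_complex (L : Set ℂ) (ζ : ℂ) : HyperplaneConditionAt L ζ := by
  by_cases h : ∃ r₀ > 0, Metric.ball ζ r₀ ⊆ L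
  · obtain ⟨r₀, hr₀, h⟩ := h
    exact ⟨r₀, hr₀, .inl h⟩
  push Not at h
  refine ⟨1, one_pos, .inr fun r hr => ?_⟩
  obtain ⟨w, hw, hwL⟩ := not_subset.1 (h r hr.1)
  exact ⟨w, hw, .id ℂ ℂ, fun z hz _ heq => hwL ((show z = w from heq) ▸ hz)⟩

theorem isUniquenessSetAt_of_accPt {L : Set ℂ} {ζ : ℂ} (h : AccPt ζ (𝓟 L)) :
    IsUniquenessSetAt L ζ := by
  intro r hr G hG hG0
  have hana := hG.analyticOnNhd Metric.isOpen_ball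
  have hball : ∀ᶠ z in 𝓝[≠] ζ, z ∈ Metric.ball ζ r :=
    mem_nhdsWithin_of_mem_nhds (Metric.ball_mem_nhds ζ hr)
  have hfreq : ∃ᶠ z in 𝓝[≠] ζ, G z = 0 :=
    ((accPt_iff_frequently_nhdsNE.1 h).and_eventually hball).mono fun z hz => hG0 z hz.1 hz.2
  exact (hana ζ (Metric.mem_ball_self hr)).frequently_zero_iff_eventually_zero.1 hfreq

/-- `C(L, ℂ)` carries the compact-open topology. As `L` is closed in a finite-dimensional space,
this is the topology of the seminorms `|f|_N = sup {|f z| : z ∈ L, ‖z‖ ≤ N}`. -/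
theorem mainTheorem3 :
    (∀ n : ℕ, 1 ≤ n → ∀ L : Set (EuclideanSpace ℂ (Fin n)), IsClosed L →
      HyperplaneCondition L → SliceCondition L →
        (∀ ζ : L, IsGδ (nonExtendableAt L ζ) ∧ Dense (nonExtendableAt L ζ)) ∧
        (IsGδ (nowhereExtendable L) ∧ Dense (nowhereExtendable L))) ∧
    (∀ L : Set ℂ, Perfect L →
        (∀ ζ : L, IsGδ (nonExtendableAt L ζ) ∧ Dense (nonExtendableAt L ζ)) ∧
        (IsGδ (nowhereExtendable L) ∧ Dense (nowhereExtendable L))) := by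
  constructor
  · intro n hn L hL hH hS
    have : Nonempty (Fin n) := ⟨⟨0, hn⟩⟩
    exact isGδ_and_dense_nonExtendable hL hH.hyperplaneConditionAt hS.isUniquenessSetAt
  · intro L hL
    exact isGδ_and_dense_nonExtendable hL.closed (fun ζ _ => hyperplaneConditionAt_complex L ζ)
      fun ζ hζ => isUniquenessSetAt_of_accPt (hL.acc ζ hζ)
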